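/- Let $B_n(a)\in\mathbb{Q}[a]$ be the Bernoulli polynomials, $\sum_{n\ge 0}B_n(a)\frac{x^n}{n!}=\frac{xe^{ax}}{e^x-1}$. For $r\ge 1$ and $d_1,\dots,d_{r-1}\in\{0,1\}$ let $S^{(d_1,\dots,d_{r-1})}$ be the set of all $(n_1,\dots,n_r)\in\mathbb{Z}_{\ge 0}^r$ with $n_1+\cdots+n_r=r$ such that, for every $1\le j\le r-1$, $$n_{j+1}+\cdots+n_r\le r-j\ \text{ if } d_j=0,\qquad n_1+\cdots+n_j<j\ \text{ if } d_j=1,$$ and define $$C^{(d_1,\dots,d_{r-1})}(a_1,\dots,a_r)=(-1)^r\sum_{(n_1,\dots,n_r)\in S^{(d_1,\dots,d_{r-1})}}\frac{B_{n_1}(a_1)}{n_1!}\cdots\frac{B_{n_r}(a_r)}{n_r!}$$ (the coefficients in the asymptotic formula at the origin of the Hurwitz multiple zeta function with shifts $a_1,\dots,a_r$). For $1\le i\le r$ put $$C_{i,r}(a)=C^{(1,\dots,1,0,\dots,0)}(a,\dots,a)\in\mathbb{Q}[a],$$ where the superscript has $i-1$ entries $1$ followed by $r-i$ entries $0$. Let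 $L(a,t)\in\mathbb{Q}[a][[t]]$ be the compositional inverse, with respect to $t$, of the formal power series $e^{-at}(e^t-1)$. The generalized Gregory polynomials $G_{m,n}(a)\in\mathbb{Q}[a]$ are defined by the identity of formal power series $$\sum_{m,n\ge 0}G_{m,n}(a)\,x^my^n=\frac{y\,L(a,-x)^2-x\,L(a,-y)^2}{-L(a,-x)+L(a,-y)}\in\mathbb{Q}[a][[x,y]],$$ where the denominator is nonzero and divides the numerator in $\mathbb{Q}[a][[x,y]]$. **Theorem.** For all integers $1\le i\le r$, $$C_{i,r}(a)=G_{i,\,r-i+2}(a)\quad\text{in }\mathbb{Q}[a].$$ -/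

import Mathlib

open Polynomial

namespace HurwitzGregory

/-! Throughout, the shift `a` is the indeterminate `X` of `ℚ[X]`, and formal power series have
coefficients in `ℚ[X]`. -/

/-! ### The asymptotic coefficients -/

/-- The set `S_{j,r}^{(d)}` of tuples `n = (n_1, …, n_r)` of non-negative integers with
`n_1 + ⋯ + n_r = r` and
* `n_{j+1} + ⋯ + n_r ≤ r - j` if `d = 0` (`false`),
* `n_1 + ⋯ + n_j < j` if `d = 1` (`true`).

The entry `n_k` is `n ⟨k - 1, _⟩`, so `n_1, …, n_j` are the entries with index `< j`. -/
def singleIndexSet (r j : ℕ) (d : Bool) : Finset (Fin r → ℕ) :=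
  {n ∈ Finset.piAntidiag Finset.univ r |
    if d then (∑ k with k.val < j, n k) < j else (∑ k with j ≤ k.val, n k) ≤ r - j}

/-- The set `S^{(d_1, …, d_{r-1})} = ⋂_{j=1}^{r-1} S_{j,r}^{(d_j)}`, as a subset of the tuples of
sum `r` (so that for `r = 1` it consists of the tuple `(1)`). The entry `d_j` is
`d ⟨j - 1, _⟩`. -/
def indexSet (r : ℕ) (d : Fin (r - 1) → Bool) : Finset (Fin r → ℕ) :=
  {n ∈ Finset.piAntidiag Finset.univ r |
    ∀ j : Fin (r - 1), n ∈ singleIndexSet r (j.val + 1) (d j)}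

/-- The coefficient `C^{(d_1, …, d_{r-1})}(a_1, …, a_r)`, for `a_1, …, a_r` in any commutative
`ℚ`-algebra; `Polynomial.bernoulli n` is the `n`-th Bernoulli polynomial. -/
noncomputable def asympCoeff {A : Type*} [CommRing A] [Algebra ℚ A] (r : ℕ)
    (d : Fin (r - 1) → Bool) (a : Fin r → A) : A :=
  (-1) ^ r * ∑ n ∈ indexSet r d,
    ∏ k, ((n k).factorial : ℚ)⁻¹ • aeval (a k) (Polynomial.bernoulli (n k))

/-- The primitive coefficient `C_{i,r}(a) = C^{(1, …, 1, 0, …, 0)}(a, …, a) ∈ ℚ[a]`, with `i - 1`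
occurrences of `1` in the superscript. -/
noncomputable def primCoeff (i r : ℕ) : ℚ[X] :=
  asympCoeff r (fun j => decide (j.val + 1 < i)) (fun _ => (X : ℚ[X]))

/-! ### The series `L(a,t)` -/

/-- The power series `e^{-at}(e^t - 1)`. -/
noncomputable def expKernel : PowerSeries ℚ[X] :=
  PowerSeries.rescale (-X : ℚ[X]) (PowerSeries.exp ℚ[X]) * (PowerSeries.exp ℚ[X] - 1)

theorem constantCoeff_expKernel : PowerSeries.constantCoeff expKernel = 0 := by
  simp [expKernel]

theorem coeff_one_expKernel : PowerSeries.coeff 1 expKernel = 1 := by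
  rw [expKernel, PowerSeries.coeff_mul, Finset.Nat.antidiagonal_succ]
  simp [PowerSeries.coeff_rescale]

theorem isUnit_coeff_one_expKernel : IsUnit (PowerSeries.coeff 1 expKernel) := by
  rw [coeff_one_expKernel]; exact isUnit_one

/-- The series `L(a,t)`, the compositional inverse of `e^{-at}(e^t - 1)`. -/
noncomputable def L : PowerSeries ℚ[X] :=
  expKernel.substInvOfIsUnit isUnit_coeff_one_expKernel

theorem constantCoeff_L : PowerSeries.constantCoeff L = 0 :=
  PowerSeries.constantCoeff_substInvOfIsUnit _ _

theorem coeff_one_L : PowerSeries.coeff 1 L = 1 := by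
  have h := PowerSeries.coeff_one_substInvOfIsUnit expKernel isUnit_coeff_one_expKernel
  have h2 : isUnit_coeff_one_expKernel.unit = 1 := Units.ext coeff_one_expKernel
  rw [h2] at h
  simpa [L] using h

theorem expKernel_subst_L : expKernel.subst L = (PowerSeries.X : PowerSeries ℚ[X]) :=
  PowerSeries.subst_substInvOfIsUnit_right _ constantCoeff_expKernel _

/-- The functional equation `e^{L(a,t)} (1 - t e^{(a-1)L(a,t)}) = 1`. -/
theorem exp_L_mul :
    (PowerSeries.exp ℚ[X]).subst L *
      (1 - (PowerSeries.X : PowerSeries ℚ[X]) *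
        (PowerSeries.rescale (X - 1 : ℚ[X]) (PowerSeries.exp ℚ[X])).subst L) = 1 := by
  have hL : PowerSeries.HasSubst L := PowerSeries.HasSubst.of_constantCoeff_zero' constantCoeff_L
  have hinv (c : ℚ[X]) : PowerSeries.exp ℚ[X] * PowerSeries.rescale c (PowerSeries.exp ℚ[X]) =
      PowerSeries.rescale (1 + c) (PowerSeries.exp ℚ[X]) := by
    simpa using PowerSeries.exp_mul_exp_eq_exp_add (1 : ℚ[X]) c
  have key : PowerSeries.exp ℚ[X] *
      (1 - expKernel * PowerSeries.rescale (X - 1 : ℚ[X]) (PowerSeries.exp ℚ[X])) = 1 := by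
    have h1 := hinv (X - 1)
    have h2 := PowerSeries.exp_mul_exp_eq_exp_add (-X : ℚ[X]) X
    rw [show (1 : ℚ[X]) + (X - 1) = X by ring] at h1
    simp only [neg_add_cancel, PowerSeries.rescale_zero_apply, PowerSeries.constantCoeff_exp,
      map_one] at h2
    rw [expKernel]
    linear_combination (-(PowerSeries.rescale (-X : ℚ[X]) (PowerSeries.exp ℚ[X]) *
      (PowerSeries.exp ℚ[X] - 1))) * h1 - (PowerSeries.exp ℚ[X] - 1) * h2
  have h := congrArg (PowerSeries.substAlgHom hL) key
  simpa only [map_mul, map_sub, map_one, PowerSeries.coe_substAlgHom, expKernel_subst_L] using h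

/-! ### Generalized Gregory polynomials -/

/-- The series `-L(a,-t)`, which generalizes `log(1+t)`. -/
noncomputable def negL : PowerSeries ℚ[X] :=
  -PowerSeries.rescale (-1 : ℚ[X]) L

/-- The two-variable series `-L(a,-x)` for `i = 0` and `-L(a,-y)` for `i = 1`. -/
noncomputable def logSeries (i : Fin 2) : MvPowerSeries (Fin 2) ℚ[X] :=
  negL.subst (MvPowerSeries.X i : MvPowerSeries (Fin 2) ℚ[X])

/-- The denominator `-L(a,-x) + L(a,-y)`. -/
noncomputable def gregoryDen : MvPowerSeries (Fin 2) ℚ[X] :=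
  logSeries 0 - logSeries 1

/-- The numerator `y L(a,-x)^2 - x L(a,-y)^2`. -/
noncomputable def gregoryNum : MvPowerSeries (Fin 2) ℚ[X] :=
  MvPowerSeries.X 1 * logSeries 0 ^ 2 - MvPowerSeries.X 0 * logSeries 1 ^ 2

/-- The series `∑ f_{i+j+1} x^i y^j`, that is, `(f(x) - f(y)) / (x - y)`. -/
noncomputable def divDiff (f : PowerSeries ℚ[X]) : MvPowerSeries (Fin 2) ℚ[X] :=
  fun e => PowerSeries.coeff (e 0 + e 1 + 1) f

theorem subst_sub_subst (f : PowerSeries ℚ[X]) :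
    f.subst (MvPowerSeries.X 0 : MvPowerSeries (Fin 2) ℚ[X]) -
      f.subst (MvPowerSeries.X 1 : MvPowerSeries (Fin 2) ℚ[X]) =
    (MvPowerSeries.X 0 - MvPowerSeries.X 1) * divDiff f := by
  ext1 e
  have hX (s : Fin 2) : MvPowerSeries.coeff e (MvPowerSeries.X s * divDiff f) =
      if 1 ≤ e s then PowerSeries.coeff (e 0 + e 1) f else 0 := by
    rw [MvPowerSeries.X, MvPowerSeries.coeff_monomial_mul]
    simp only [Finsupp.single_le_iff, one_mul]
    split_ifs with h
    · change PowerSeries.coeff _ f = _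
      congr 2
      fin_cases s <;> simp at h ⊢ <;> omega
    · rfl
  have h0 : e = Finsupp.single 0 (e 0) ↔ e 1 = 0 := by
    rw [Finsupp.ext_iff]; simp [Fin.forall_fin_two]
  have h1 : e = Finsupp.single 1 (e 1) ↔ e 0 = 0 := by
    rw [Finsupp.ext_iff]; simp [Fin.forall_fin_two]
  rw [sub_mul, map_sub, map_sub, hX, hX, PowerSeries.coeff_subst_single,
    PowerSeries.coeff_subst_single]
  simp only [h0, h1]
  rcases Nat.eq_zero_or_pos (e 0) with h | h <;> rcases Nat.eq_zero_or_pos (e 1) with h' | h' <;>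
    simp [h, h', Nat.one_le_iff_ne_zero, Nat.pos_iff_ne_zero.1]

theorem constantCoeff_negL : PowerSeries.constantCoeff negL = 0 := by
  rw [negL, map_neg, ← PowerSeries.coeff_zero_eq_constantCoeff_apply, PowerSeries.coeff_rescale,
    PowerSeries.coeff_zero_eq_constantCoeff_apply, constantCoeff_L, mul_zero, neg_zero]

theorem coeff_one_negL : PowerSeries.coeff 1 negL = 1 := by
  simp [negL, PowerSeries.coeff_rescale, coeff_one_L]

theorem gregoryDen_eq :
    gregoryDen = (MvPowerSeries.X 0 - MvPowerSeries.X 1) * divDiff negL :=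
  subst_sub_subst negL

theorem isUnit_divDiff_negL : IsUnit (divDiff negL) := by
  rw [MvPowerSeries.isUnit_iff_constantCoeff]
  have : MvPowerSeries.constantCoeff (divDiff negL) = 1 := coeff_one_negL
  rw [this]; exact isUnit_one

theorem gregoryDen_dvd_gregoryNum : gregoryDen ∣ gregoryNum := by
  obtain ⟨u, hu⟩ : PowerSeries.X ∣ negL := PowerSeries.X_dvd_iff.2 constantCoeff_negL
  have hlog (i : Fin 2) : logSeries i =
      MvPowerSeries.X i * u.subst (MvPowerSeries.X i : MvPowerSeries (Fin 2) ℚ[X]) := by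
    have hi : PowerSeries.HasSubst (MvPowerSeries.X i : MvPowerSeries (Fin 2) ℚ[X]) :=
      PowerSeries.HasSubst.X i
    rw [logSeries, hu, PowerSeries.subst_mul hi, PowerSeries.subst_X hi]
  have hg (i : Fin 2) : (PowerSeries.X * u ^ 2).subst
      (MvPowerSeries.X i : MvPowerSeries (Fin 2) ℚ[X]) =
      MvPowerSeries.X i * u.subst (MvPowerSeries.X i : MvPowerSeries (Fin 2) ℚ[X]) ^ 2 := by
    have hi : PowerSeries.HasSubst (MvPowerSeries.X i : MvPowerSeries (Fin 2) ℚ[X]) :=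
      PowerSeries.HasSubst.X i
    rw [PowerSeries.subst_mul hi, PowerSeries.subst_X hi, PowerSeries.subst_pow hi]
  have h := subst_sub_subst (PowerSeries.X * u ^ 2)
  rw [hg, hg] at h
  rw [gregoryDen_eq, isUnit_divDiff_negL.mul_right_dvd]
  refine ⟨MvPowerSeries.X 0 * MvPowerSeries.X 1 * divDiff (PowerSeries.X * u ^ 2), ?_⟩
  rw [gregoryNum, hlog, hlog]
  linear_combination (MvPowerSeries.X 0 * MvPowerSeries.X 1) * h

theorem gregoryDen_ne_zero : gregoryDen ≠ 0 := by
  rw [gregoryDen_eq]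
  refine mul_ne_zero (fun h => ?_) isUnit_divDiff_negL.ne_zero
  exact absurd (MvPowerSeries.X_inj.1 (sub_eq_zero.1 h)) (by decide)

/-- The generating series `𝒢(x,y;a)`, the quotient of `gregoryNum` by `gregoryDen` in the domain
`ℚ[a]⟦x,y⟧`. -/
noncomputable def gregorySeries : MvPowerSeries (Fin 2) ℚ[X] :=
  gregoryDen_dvd_gregoryNum.choose

theorem gregorySeries_unique (g : MvPowerSeries (Fin 2) ℚ[X]) :
    gregoryDen * g = gregoryNum ↔ g = gregorySeries := by
  have h : gregoryNum = gregoryDen * gregorySeries := gregoryDen_dvd_gregoryNum.choose_spec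
  rw [h]
  exact mul_right_inj' gregoryDen_ne_zero

/-- The generalized Gregory polynomial `G_{m,n}(a)`, the coefficient of `x^m y^n` in
`𝒢(x,y;a)`. -/
noncomputable def gregoryPoly (m n : ℕ) : ℚ[X] :=
  MvPowerSeries.coeff (Finsupp.single 0 m + Finsupp.single 1 n) gregorySeries

end HurwitzGregory

/-! Put `φ(t) = ∑ b_n t^n` with `b_n = (-1)^n B_n(a)/n!`. The sign `(-1)^r` is absorbed into the
product since the `n_k` sum to `r`, so `C_{i,r}` is a weighted count of closed walks with steps `n_k
- 1`: negative after each of the first `q = i - 1` steps, non-negative from then on.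

The series `l(t) = -L(a,-t)` solves `l = t φ(l)` (`negL_eq`), hence `l^(m+1) = t l^m φ(l)`, which is
a first-step recursion for walks. It shows that non-negative walks from `k` to `0` in `s` steps have
weight `[t^(s+1)] l^(k+1)` (`walkSum_nonneg`), and that the negative steps can be removed one at a
time by raising a coefficient index (`sum_coeff_mul_walkSum`). Cutting at the unique jump from `-m`
to `k ≥ 0`, of weight `b_(m+k+1)`, gives a double sum with `w = r - i` (`walkSum_crossing`): `∑
b_(m+k+1) [t^q] l^m [t^(w+1)] l^(k+1)`.

On the Gregory side, `x φ(l(x)) = l(x)` turns the quotient into `x y l(y) (φ(l(x)) - φ(l(y))) /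
(l(x) - l(y)) + y l(x)` (`gregorySeries_eq`). The divided difference of `φ` has coefficients
`b_(m+k+1)`, so the same double sum appears (`gregoryPoly_eq`). -/

namespace HurwitzGregory

/-! ### Sums over tuples with constrained partial sums -/

section Walks

variable {R : Type*} [CommRing R]

open Classical in
/-- The tuples `n` of length `s` and sum `N` such that `P j (n_1 + ⋯ + n_j)` for `1 ≤ j ≤ s`. -/
noncomputable def walkSet (s N : ℕ) (P : ℕ → ℕ → Prop) : Finset (Fin s → ℕ) :=
  {n ∈ Finset.piAntidiag Finset.univ N |
    ∀ j, 1 ≤ j → j ≤ s → P j (∑ k with k.val < j, n k)}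

/-- The sum of `b_{n_1} ⋯ b_{n_s}` over `walkSet s N P`. -/
noncomputable def walkSum (b : ℕ → R) (s N : ℕ) (P : ℕ → ℕ → Prop) : R :=
  ∑ n ∈ walkSet s N P, ∏ k, b (n k)

theorem mem_walkSet {s N : ℕ} {P : ℕ → ℕ → Prop} {n : Fin s → ℕ} :
    n ∈ walkSet s N P ↔
      ∑ k, n k = N ∧ ∀ j, 1 ≤ j → j ≤ s → P j (∑ k with k.val < j, n k) := by
  simp [walkSet]

theorem walkSum_congr (b : ℕ → R) (s N : ℕ) {P Q : ℕ → ℕ → Prop}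
    (h : ∀ j σ, P j σ ↔ Q j σ) : walkSum b s N P = walkSum b s N Q := by
  obtain rfl : P = Q := by ext j σ; exact h j σ
  rfl

theorem walkSum_zero (b : ℕ → R) (P : ℕ → ℕ → Prop) : walkSum b 0 0 P = 1 := by
  have : walkSet 0 0 P = {Fin.elim0} := by
    ext n
    simp only [mem_walkSet, Finset.mem_singleton]
    exact ⟨fun _ => Subsingleton.elim _ _, fun _ => ⟨by simp, fun j h1 h2 => by omega⟩⟩
  rw [walkSum, this]; simp

theorem sum_lt_succ_cons {s : ℕ} (x : ℕ) (n : Fin s → ℕ) (j : ℕ) :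
    ∑ k with k.val < j + 1, (Fin.cons x n : Fin (s + 1) → ℕ) k =
      x + ∑ k with k.val < j, n k := by
  rw [Finset.sum_filter, Fin.sum_univ_succ, Finset.sum_filter]
  simp

theorem cons_mem_walkSet {s N : ℕ} {P : ℕ → ℕ → Prop} {x : ℕ} {n : Fin s → ℕ} (hx : x ≤ N) :
    (Fin.cons x n : Fin (s + 1) → ℕ) ∈ walkSet (s + 1) N P ↔
      P 1 x ∧ n ∈ walkSet s (N - x) (fun j σ => P (j + 1) (x + σ)) := by
  rw [mem_walkSet, mem_walkSet, Fin.sum_cons]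
  constructor
  · rintro ⟨h, hP⟩
    refine ⟨?_, by omega, fun j h1 h2 => ?_⟩
    · have h1 := hP (0 + 1) le_rfl (by omega)
      rw [sum_lt_succ_cons] at h1
      simpa using h1
    · have h1 := hP (j + 1) (by omega) (by omega)
      rwa [sum_lt_succ_cons] at h1
  · rintro ⟨h1, h, hP⟩
    refine ⟨by omega, fun j hj hj' => ?_⟩
    obtain ⟨j, rfl⟩ := Nat.exists_eq_add_of_le' hj
    rw [sum_lt_succ_cons]
    rcases Nat.eq_zero_or_pos j with rfl | h0
    · simpa using h1
    · exact hP j h0 (by omega)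

-- Splitting off the first entry shifts the constraint on all later partial sums.
open Classical in
theorem walkSum_succ (b : ℕ → R) (s N : ℕ) (P : ℕ → ℕ → Prop) :
    walkSum b (s + 1) N P = ∑ x ∈ Finset.range (N + 1),
      if P 1 x then b x * walkSum b s (N - x) (fun j σ => P (j + 1) (x + σ)) else 0 := by
  rw [← Finset.sum_filter]
  simp only [walkSum, Finset.mul_sum]
  rw [Finset.sum_sigma']
  refine Finset.sum_bij' (fun n _ => ⟨n 0, Fin.tail n⟩) (fun p _ => Fin.cons p.1 p.2)
    ?_ ?_ ?_ ?_ ?_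
  · intro n hn
    have h0 : n 0 ≤ N := by
      rw [← (mem_walkSet.1 hn).1]
      exact Finset.single_le_sum (fun _ _ => Nat.zero_le _) (Finset.mem_univ _)
    rw [← Fin.cons_self_tail n, cons_mem_walkSet h0] at hn
    simp only [Finset.mem_sigma, Finset.mem_filter, Finset.mem_range]
    exact ⟨⟨by omega, hn.1⟩, hn.2⟩
  · rintro ⟨x, n⟩ h
    simp only [Finset.mem_sigma, Finset.mem_filter, Finset.mem_range] at h
    exact (cons_mem_walkSet (Nat.lt_succ_iff.1 h.1.1)).2 ⟨h.1.2, h.2⟩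
  · intro n _
    exact Fin.cons_self_tail n
  · rintro ⟨x, n⟩ _
    simp
  · intro n _
    rw [Fin.prod_univ_succ]
    rfl

end Walks

/-! ### Walks and the powers of the solution of `l = t φ(l)` -/

section FunctionalEquation

variable {R : Type*} [CommRing R]

theorem coeff_pow_eq_zero {l : PowerSeries R} (hl : PowerSeries.constantCoeff l = 0) {j m : ℕ}
    (h : j < m) : PowerSeries.coeff j (l ^ m) = 0 :=
  PowerSeries.X_pow_dvd_iff.1 (pow_dvd_pow_of_dvd (PowerSeries.X_dvd_iff.2 hl) m) j h

theorem coeff_subst_eq_sum_range {l : PowerSeries R} (hl : PowerSeries.constantCoeff l = 0)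
    (f : PowerSeries R) {j K : ℕ} (h : j < K) :
    PowerSeries.coeff j (f.subst l) =
      ∑ d ∈ Finset.range K, PowerSeries.coeff d f * PowerSeries.coeff j (l ^ d) := by
  rw [PowerSeries.coeff_subst' (PowerSeries.HasSubst.of_constantCoeff_zero' hl),
    finsum_eq_sum_of_support_subset (s := Finset.range K)]
  · simp only [smul_eq_mul]
  · intro d hd
    simp only [Finset.coe_range, Set.mem_Iio]
    by_contra hlt
    exact hd (by simp only [coeff_pow_eq_zero hl (show j < d by omega), smul_zero])

variable {l φ : PowerSeries R} (hl : PowerSeries.constantCoeff l = 0)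
  (hφ : l = PowerSeries.X * φ.subst l)

include hl hφ

/-- Expand `l^(m+1) = t l^m φ(l)`. Since `l^d` has order at least `d`, truncating at `d < m + K`
loses nothing in degree `j`. -/
theorem coeff_succ_pow_succ {j m K : ℕ} (h : j < m + K) :
    PowerSeries.coeff (j + 1) (l ^ (m + 1)) =
      ∑ n ∈ Finset.range K, PowerSeries.coeff n φ * PowerSeries.coeff j (l ^ (m + n)) := by
  have hs := PowerSeries.HasSubst.of_constantCoeff_zero' hl
  have h1 : l ^ (m + 1) = PowerSeries.X * (PowerSeries.X ^ m * φ).subst l := by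
    rw [PowerSeries.subst_mul hs, PowerSeries.subst_pow hs, PowerSeries.subst_X hs]
    linear_combination l ^ m * hφ
  rw [h1, PowerSeries.coeff_succ_X_mul, coeff_subst_eq_sum_range hl _ h, Finset.sum_range_add]
  rw [Finset.sum_eq_zero, zero_add]
  · refine Finset.sum_congr rfl fun n _ => ?_
    rw [add_comm m n, PowerSeries.coeff_X_pow_mul]
  · intro d hd
    rw [PowerSeries.coeff_X_pow_mul', if_neg (by simpa using hd), zero_mul]

/-- These walks start at height `k`, stay non-negative and end at `0`; both sides obey the same
first-step recursion. -/
theorem walkSum_nonneg (h0 : PowerSeries.coeff 0 φ = 1) (s k N : ℕ) (h : N + k = s) :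
    walkSum (fun n => PowerSeries.coeff n φ) s N (fun j σ => j ≤ k + σ) =
      PowerSeries.coeff (s + 1) (l ^ (k + 1)) := by
  induction s generalizing k N with
  | zero =>
    obtain ⟨rfl, rfl⟩ : N = 0 ∧ k = 0 := by omega
    rw [walkSum_zero, coeff_succ_pow_succ hl hφ (K := 1) (by omega)]
    simp [h0]
  | succ s ih =>
    rw [walkSum_succ, coeff_succ_pow_succ hl hφ (K := N + 1) (by omega)]
    refine Finset.sum_congr rfl fun x hx => ?_
    rw [Finset.mem_range] at hx
    split_ifs with h1
    · obtain ⟨k', hk'⟩ := Nat.exists_eq_add_of_le' h1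
      rw [hk', ← ih k' (N - x) (by omega)]
      congr 1
      exact walkSum_congr _ _ _ fun j σ => by omega
    -- The forbidden step from `0` to `-1` matches the term `l^0 = 1`, which has no coefficient in
    -- positive degree.
    · obtain ⟨rfl, rfl⟩ : k = 0 ∧ x = 0 := by omega
      simp

/-- The condition that a walk with steps `n_j - 1` starting at `-m` is negative after `1, …, q`
steps and non-negative afterwards. -/
def crossing (q m j σ : ℕ) : Prop := if j ≤ q then σ < j + m else j + m ≤ σ

omit hl hφ in
theorem walkSum_crossing_succ (b : ℕ → R) (w q m : ℕ) :
    walkSum b (q + 1 + 1 + w) (q + 1 + 1 + w + m) (crossing (q + 1) m) =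
      ∑ x ∈ Finset.range (m + 1), b x *
        walkSum b (q + 1 + w) (q + 1 + w + (m + 1 - x)) (crossing q (m + 1 - x)) := by
  rw [show q + 1 + 1 + w = (q + 1 + w) + 1 by omega, walkSum_succ, ← Finset.sum_filter]
  refine Finset.sum_congr ?_ fun x hx => ?_
  · ext x
    simp only [Finset.mem_filter, Finset.mem_range]
    rw [crossing, if_pos (by omega)]
    omega
  · rw [Finset.mem_range] at hx
    rw [show q + 1 + w + 1 + m - x = q + 1 + w + (m + 1 - x) by omega]
    congr 1
    refine walkSum_congr _ _ _ fun j σ => ?_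
    unfold crossing
    split_ifs <;> omega

/-- With no negative steps left, the first step must jump from `-m` to some `k ≥ 0`, so its entry is
`m + k + 1`; a non-negative walk of `w` steps follows. -/
theorem walkSum_crossing_zero (h0 : PowerSeries.coeff 0 φ = 1) (w m : ℕ) :
    walkSum (fun n => PowerSeries.coeff n φ) (0 + 1 + w) (0 + 1 + w + m) (crossing 0 m) =
      ∑ k ∈ Finset.range (w + 1),
        PowerSeries.coeff (m + k + 1) φ * PowerSeries.coeff (w + 1) (l ^ (k + 1)) := by
  rw [show 0 + 1 + w = w + 1 by omega, walkSum_succ,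
    show w + 1 + m + 1 = (m + 1) + (w + 1) by omega, Finset.sum_range_add, Finset.sum_eq_zero,
    zero_add]
  · refine Finset.sum_congr rfl fun k hk => ?_
    rw [Finset.mem_range] at hk
    rw [if_pos (by simp only [crossing]; rw [if_neg (by omega)]; omega),
      show m + 1 + k = m + k + 1 by omega, ← walkSum_nonneg hl hφ h0 w k (w - k) (by omega),
      show w + 1 + m - (m + k + 1) = w - k by omega]
    congr 1
    refine walkSum_congr _ _ _ fun j σ => ?_
    unfold crossing
    rw [if_neg (by omega)]
    omega
  · intro x hx
    rw [Finset.mem_range] at hx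
    rw [if_neg]
    simp only [crossing]
    rw [if_neg (by omega)]
    omega

/-- One negative step is traded for one degree: a step from `-m` to `-(m + 1 - x)` has weight `b_x`,
and summing over `m` rebuilds the expansion of `[t^(j+1)] l^(m+1-x)`. -/
theorem sum_coeff_mul_walkSum (w q j : ℕ) :
    ∑ m ∈ Finset.range (j + 1), PowerSeries.coeff j (l ^ m) *
        walkSum (fun n => PowerSeries.coeff n φ) (q + 1 + 1 + w) (q + 1 + 1 + w + m)
          (crossing (q + 1) m) =
      ∑ m ∈ Finset.range (j + 2), PowerSeries.coeff (j + 1) (l ^ m) *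
        walkSum (fun n => PowerSeries.coeff n φ) (q + 1 + w) (q + 1 + w + m) (crossing q m) := by
  rw [Finset.sum_range_succ' _ (j + 1)]
  simp only [pow_zero, PowerSeries.coeff_one, Nat.succ_ne_zero, if_false, zero_mul, add_zero]
  simp only [walkSum_crossing_succ, Finset.mul_sum]
  -- This choice of `K` makes both double sums range over `x ≤ m ≤ j`, up to the shift `m ↦ m - x`.
  have h (m : ℕ) := coeff_succ_pow_succ hl hφ (j := j) (m := m) (K := j + 1 - m) (by omega)
  simp only [h, Finset.sum_mul]
  rw [Finset.sum_sigma', Finset.sum_sigma']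
  refine Finset.sum_bij' (fun p _ => ⟨p.1 - p.2, p.2⟩) (fun p _ => ⟨p.1 + p.2, p.2⟩) ?_ ?_ ?_ ?_ ?_
  · rintro ⟨m, x⟩ hp
    simp only [Finset.mem_sigma, Finset.mem_range] at hp ⊢
    omega
  · rintro ⟨m, x⟩ hp
    simp only [Finset.mem_sigma, Finset.mem_range] at hp ⊢
    omega
  · rintro ⟨m, x⟩ hp
    simp only [Finset.mem_sigma, Finset.mem_range] at hp
    simp only [Sigma.mk.injEq, heq_eq_eq, and_true]
    omega
  · rintro ⟨m, x⟩ hp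
    simp
  · rintro ⟨m, x⟩ hp
    simp only [Finset.mem_sigma, Finset.mem_range] at hp
    simp only
    rw [show m + 1 - x = m - x + 1 by omega, Nat.sub_add_cancel (by omega)]
    ring

theorem sum_coeff_mul_walkSum_crossing (w q j : ℕ) :
    ∑ m ∈ Finset.range (j + 1), PowerSeries.coeff j (l ^ m) *
        walkSum (fun n => PowerSeries.coeff n φ) (q + 1 + w) (q + 1 + w + m) (crossing q m) =
      ∑ m ∈ Finset.range (j + q + 1), PowerSeries.coeff (j + q) (l ^ m) *
        walkSum (fun n => PowerSeries.coeff n φ) (0 + 1 + w) (0 + 1 + w + m) (crossing 0 m) := by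
  induction q generalizing j with
  | zero => rfl
  | succ q ih =>
    rw [sum_coeff_mul_walkSum hl hφ, ih (j + 1), show j + 1 + q = j + (q + 1) by omega]

theorem walkSum_crossing (h0 : PowerSeries.coeff 0 φ = 1) (w q : ℕ) :
    walkSum (fun n => PowerSeries.coeff n φ) (q + 1 + w) (q + 1 + w) (crossing q 0) =
      ∑ m ∈ Finset.range (q + 1), ∑ k ∈ Finset.range (w + 1), PowerSeries.coeff (m + k + 1) φ *
        (PowerSeries.coeff q (l ^ m) * PowerSeries.coeff (w + 1) (l ^ (k + 1))) := by
  -- At `j = 0` only `m = 0` survives on the left, leaving the walk sum that starts at `0`.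
  have h := sum_coeff_mul_walkSum_crossing hl hφ w q 0
  simp only [zero_add, Finset.sum_range_one, pow_zero, PowerSeries.coeff_zero_one, one_mul,
    add_zero] at h
  rw [h]
  refine Finset.sum_congr rfl fun m _ => ?_
  have h' := walkSum_crossing_zero hl hφ h0 w m
  rw [zero_add] at h'
  rw [h', Finset.mul_sum]
  exact Finset.sum_congr rfl fun k _ => by ring

end FunctionalEquation

/-! ### The primitive coefficients as sums over walks -/

/-- The series `∑ (-1)^n B_n(a) t^n / n!`. -/
noncomputable def bernoulliSeries : PowerSeries ℚ[X] :=
  PowerSeries.mk fun n => (-1) ^ n * ((n.factorial : ℚ)⁻¹ • Polynomial.bernoulli n)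

theorem coeff_zero_bernoulliSeries : PowerSeries.coeff 0 bernoulliSeries = 1 := by
  simp [bernoulliSeries]

/-- As the total is `r`, a bound on the tail is a bound on the initial partial sum. -/
theorem mem_singleIndexSet_iff {r j : ℕ} (hj : j ≤ r) (d : Bool) (n : Fin r → ℕ)
    (hn : ∑ k, n k = r) :
    n ∈ singleIndexSet r j d ↔
      if d then (∑ k with k.val < j, n k) < j else j ≤ ∑ k with k.val < j, n k := by
  have h := Finset.sum_filter_add_sum_filter_not Finset.univ (fun k : Fin r => k.val < j) n
  simp only [not_lt, hn] at h
  simp only [singleIndexSet, Finset.mem_filter, Finset.mem_piAntidiag, hn]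
  cases d
  · simp only [Bool.false_eq_true, if_false]
    simp
    omega
  · simp

theorem indexSet_eq_walkSet (w q : ℕ) :
    indexSet (q + 1 + w) (fun j => decide (j.val + 1 < q + 1)) =
      walkSet (q + 1 + w) (q + 1 + w) (crossing q 0) := by
  ext n
  rw [mem_walkSet]
  simp only [indexSet, Finset.mem_filter, Finset.mem_piAntidiag, Finset.mem_univ, implies_true,
    and_true]
  refine and_congr_right fun hn => ⟨fun h j h1 h2 => ?_, fun h j => ?_⟩
  · rcases h2.lt_or_eq with h2 | rfl
    · have := h ⟨j - 1, by omega⟩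
      rw [mem_singleIndexSet_iff (by simp; omega) _ _ hn] at this
      simp only [decide_eq_true_eq, Nat.sub_add_cancel h1] at this
      unfold crossing
      split_ifs at this ⊢ <;> omega
    -- The endpoint `j = r`, absent from `indexSet`, holds because the total is `r`.
    · rw [crossing, if_neg (by omega)]
      simp [hn]
  · have hj := j.2
    rw [mem_singleIndexSet_iff (by omega) _ _ hn]
    have := h (j.val + 1) (by omega) (by omega)
    unfold crossing at this
    simp only [decide_eq_true_eq]
    split_ifs at this ⊢ <;> omega

theorem primCoeff_eq_walkSum (w q : ℕ) :
    primCoeff (q + 1) (q + 1 + w) = walkSum (fun n => PowerSeries.coeff n bernoulliSeries)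
      (q + 1 + w) (q + 1 + w) (crossing q 0) := by
  rw [primCoeff, asympCoeff, indexSet_eq_walkSet, walkSum, Finset.mul_sum]
  refine Finset.sum_congr rfl fun n hn => ?_
  simp only [bernoulliSeries, PowerSeries.coeff_mk, Finset.prod_mul_distrib,
    Finset.prod_pow_eq_pow_sum, (mem_walkSet.1 hn).1, Polynomial.aeval_X_left_apply]

/-! ### The functional equation of `negL` -/

theorem mk_bernoulli_mul_expKernel :
    PowerSeries.mk (fun n => ((n.factorial : ℚ)⁻¹ • Polynomial.bernoulli n)) * expKernel =
      PowerSeries.X := by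
  have h := Polynomial.bernoulli_generating_function (X : ℚ[X])
  simp only [one_div, Polynomial.aeval_X_left_apply] at h
  have h2 := PowerSeries.exp_mul_exp_eq_exp_add (-X : ℚ[X]) X
  simp only [neg_add_cancel, PowerSeries.rescale_zero_apply, PowerSeries.constantCoeff_exp,
    map_one] at h2
  rw [expKernel]
  linear_combination PowerSeries.rescale (-X : ℚ[X]) (PowerSeries.exp ℚ[X]) * h +
    PowerSeries.X * h2

theorem bernoulliSeries_eq_rescale : bernoulliSeries = PowerSeries.rescale (-1)
    (PowerSeries.mk (fun n => ((n.factorial : ℚ)⁻¹ • Polynomial.bernoulli n))) := by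
  ext1 n
  rw [bernoulliSeries, PowerSeries.coeff_rescale, PowerSeries.coeff_mk, PowerSeries.coeff_mk]

theorem L_eq : (PowerSeries.mk (fun n => ((n.factorial : ℚ)⁻¹ • Polynomial.bernoulli n))).subst L *
    PowerSeries.X = L := by
  have hL : PowerSeries.HasSubst L := PowerSeries.HasSubst.of_constantCoeff_zero' constantCoeff_L
  have h := congrArg (PowerSeries.subst L) mk_bernoulli_mul_expKernel
  rwa [PowerSeries.subst_mul hL, PowerSeries.subst_X hL, expKernel_subst_L] at h

theorem rescale_subst_neg_rescale {R : Type*} [CommRing R] (f : PowerSeries R) {g : PowerSeries R}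
    (hg : PowerSeries.constantCoeff g = 0) :
    (PowerSeries.rescale (-1) f).subst (-PowerSeries.rescale (-1) g) =
      PowerSeries.rescale (-1) (f.subst g) := by
  have hs : PowerSeries.HasSubst g := PowerSeries.HasSubst.of_constantCoeff_zero' hg
  have hs' : PowerSeries.HasSubst (-PowerSeries.rescale (-1) g) := by
    refine PowerSeries.HasSubst.of_constantCoeff_zero' ?_
    rw [map_neg, ← PowerSeries.coeff_zero_eq_constantCoeff_apply, PowerSeries.coeff_rescale,
      PowerSeries.coeff_zero_eq_constantCoeff_apply, hg, mul_zero, neg_zero]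
  have hX : PowerSeries.HasSubst ((-1 : R) • PowerSeries.X : PowerSeries R) :=
    PowerSeries.HasSubst.smul_X' _
  have h1 : ((-1 : R) • PowerSeries.X : PowerSeries R).subst (-PowerSeries.rescale (-1) g) =
      g.subst ((-1 : R) • PowerSeries.X : PowerSeries R) := by
    rw [PowerSeries.subst_smul hs', PowerSeries.subst_X hs', ← PowerSeries.rescale_eq_subst,
      neg_smul, one_smul, neg_neg]
  rw [PowerSeries.rescale_eq_subst (-1) f, PowerSeries.rescale_eq_subst (-1) (f.subst g),
    PowerSeries.subst_comp_subst_apply hX hs', h1, ← PowerSeries.subst_comp_subst_apply hs hX]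

/-- This is `L_eq` under `t ↦ -t`. -/
theorem negL_eq : negL = PowerSeries.X * bernoulliSeries.subst negL := by
  have h := congrArg (PowerSeries.rescale (-1 : ℚ[X])) L_eq
  rw [map_mul, PowerSeries.rescale_X, map_neg, map_one] at h
  rw [bernoulliSeries_eq_rescale, negL, rescale_subst_neg_rescale _ constantCoeff_L]
  linear_combination h

/-! ### The generating series of the Gregory polynomials -/

theorem constantCoeff_logSeries (i : Fin 2) : MvPowerSeries.constantCoeff (logSeries i) = 0 :=
  PowerSeries.constantCoeff_subst_eq_zero (by simp) _ constantCoeff_negL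

theorem hasSubst_logSeries : MvPowerSeries.HasSubst logSeries :=
  MvPowerSeries.hasSubst_of_constantCoeff_zero constantCoeff_logSeries

theorem subst_logSeries_subst_X (f : PowerSeries ℚ[X]) (i : Fin 2) :
    MvPowerSeries.subst logSeries (f.subst (MvPowerSeries.X i : MvPowerSeries (Fin 2) ℚ[X])) =
      f.subst (logSeries i) := by
  rw [PowerSeries.subst, MvPowerSeries.subst_comp_subst_apply
    (PowerSeries.HasSubst.X i).const hasSubst_logSeries]
  simp only [MvPowerSeries.subst_X hasSubst_logSeries]
  rfl

theorem logSeries_eq (i : Fin 2) :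
    logSeries i = MvPowerSeries.X i * bernoulliSeries.subst (logSeries i) := by
  have hi : PowerSeries.HasSubst (MvPowerSeries.X i : MvPowerSeries (Fin 2) ℚ[X]) :=
    PowerSeries.HasSubst.X i
  have hl : PowerSeries.HasSubst negL :=
    PowerSeries.HasSubst.of_constantCoeff_zero' constantCoeff_negL
  conv_lhs => rw [logSeries, negL_eq]
  rw [PowerSeries.subst_mul hi, PowerSeries.subst_X hi, PowerSeries.subst_comp_subst_apply hl hi]
  rfl

theorem gregorySeries_eq :
    gregorySeries = MvPowerSeries.X 0 * (MvPowerSeries.X 1 *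
      MvPowerSeries.subst logSeries (MvPowerSeries.X 1 * divDiff bernoulliSeries)) +
      MvPowerSeries.X 1 * logSeries 0 := by
  symm
  rw [← gregorySeries_unique, gregoryDen, gregoryNum]
  have h := congrArg (MvPowerSeries.subst logSeries) (subst_sub_subst bernoulliSeries)
  rw [MvPowerSeries.subst_sub hasSubst_logSeries, MvPowerSeries.subst_mul hasSubst_logSeries,
    MvPowerSeries.subst_sub hasSubst_logSeries, subst_logSeries_subst_X, subst_logSeries_subst_X,
    MvPowerSeries.subst_X hasSubst_logSeries, MvPowerSeries.subst_X hasSubst_logSeries] at h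
  rw [MvPowerSeries.subst_mul hasSubst_logSeries, MvPowerSeries.subst_X hasSubst_logSeries]
  have h0 := logSeries_eq 0
  have h1 := logSeries_eq 1
  -- `h` clears the divided difference; `h0` and `h1` then replace `x φ(l(x))` and `y φ(l(y))` by
  -- `l(x)` and `l(y)`.
  linear_combination (-MvPowerSeries.X 0 * MvPowerSeries.X 1 * logSeries 1) * h -
    (MvPowerSeries.X 1 * logSeries 1) * h0 + (MvPowerSeries.X 0 * logSeries 1) * h1

theorem coeff_single_add_single_subst_mul_subst {R : Type*} [CommRing R] (f g : PowerSeries R)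
    (p q : ℕ) :
    MvPowerSeries.coeff (Finsupp.single 0 p + Finsupp.single 1 q)
      (f.subst (MvPowerSeries.X 0 : MvPowerSeries (Fin 2) R) *
        g.subst (MvPowerSeries.X 1 : MvPowerSeries (Fin 2) R)) =
      PowerSeries.coeff p f * PowerSeries.coeff q g := by
  classical
  rw [MvPowerSeries.coeff_mul,
    Finset.sum_eq_single (Finsupp.single 0 p, Finsupp.single 1 q)]
  · simp [PowerSeries.coeff_subst_single]
  · rintro ⟨u, v⟩ huv hne
    rw [Finset.HasAntidiagonal.mem_antidiagonal] at huv
    simp only [PowerSeries.coeff_subst_single]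
    split_ifs with hu hv
    · refine absurd ?_ hne
      have e0 := DFunLike.congr_fun huv 0
      have e1 := DFunLike.congr_fun huv 1
      rw [hu, hv] at e0 e1
      simp only [Finsupp.add_apply, Finsupp.single_eq_same, ne_eq, zero_ne_one, one_ne_zero,
        not_false_eq_true, Finsupp.single_eq_of_ne, add_zero, zero_add] at e0 e1
      rw [hu, hv, e0, e1]
    all_goals simp only [mul_zero, zero_mul]
  · intro h
    simp at h

/-- Each monomial becomes a series in `x` times a series in `y`, so its coefficient factors; the
orders of the powers of `negL` bound the range. -/
theorem coeff_subst_logSeries (f : MvPowerSeries (Fin 2) ℚ[X]) {p q M K : ℕ} (hM : p < M)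
    (hK : q < K) :
    MvPowerSeries.coeff (Finsupp.single 0 p + Finsupp.single 1 q)
      (MvPowerSeries.subst logSeries f) =
      ∑ m ∈ Finset.range M, ∑ k ∈ Finset.range K,
        MvPowerSeries.coeff (Finsupp.single 0 m + Finsupp.single 1 k) f *
          (PowerSeries.coeff p (negL ^ m) * PowerSeries.coeff q (negL ^ k)) := by
  have hc (d : Fin 2 →₀ ℕ) : MvPowerSeries.coeff (Finsupp.single 0 p + Finsupp.single 1 q)
      (d.prod fun s e => logSeries s ^ e) =
      PowerSeries.coeff p (negL ^ d 0) * PowerSeries.coeff q (negL ^ d 1) := by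
    rw [Finsupp.prod_fintype _ _ (by simp), Fin.prod_univ_two, logSeries, logSeries,
      ← PowerSeries.subst_pow (PowerSeries.HasSubst.X _),
      ← PowerSeries.subst_pow (PowerSeries.HasSubst.X _),
      coeff_single_add_single_subst_mul_subst]
  have hd (d : Fin 2 →₀ ℕ) : Finsupp.single 0 (d 0) + Finsupp.single 1 (d 1) = d := by
    ext s; fin_cases s <;> simp
  rw [MvPowerSeries.coeff_subst hasSubst_logSeries, ← Finset.sum_product',
    finsum_eq_sum_of_support_subset (s := (Finset.range M ×ˢ Finset.range K).image
      fun x => Finsupp.single 0 x.1 + Finsupp.single 1 x.2), Finset.sum_image]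
  · refine Finset.sum_congr rfl fun x _ => ?_
    rw [hc, smul_eq_mul]
    simp
  · intro x _ y _ hxy
    have e0 := DFunLike.congr_fun hxy 0
    have e1 := DFunLike.congr_fun hxy 1
    simp at e0 e1
    exact Prod.ext e0 e1
  · intro d hsupp
    simp only [Finset.coe_image, Set.mem_image, Finset.mem_coe, Finset.mem_product,
      Finset.mem_range]
    refine ⟨(d 0, d 1), ?_, hd d⟩
    by_contra hlt
    refine hsupp ?_
    simp only [hc]
    rcases not_and_or.1 hlt with h | h
    · rw [coeff_pow_eq_zero constantCoeff_negL (show p < d 0 by simp at h; omega), zero_mul,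
        smul_zero]
    · rw [coeff_pow_eq_zero constantCoeff_negL (show q < d 1 by simp at h; omega), mul_zero,
        smul_zero]

theorem coeff_X_zero_mul (f : MvPowerSeries (Fin 2) ℚ[X]) (p q : ℕ) :
    MvPowerSeries.coeff (Finsupp.single 0 (p + 1) + Finsupp.single 1 q)
      (MvPowerSeries.X 0 * f) =
      MvPowerSeries.coeff (Finsupp.single 0 p + Finsupp.single 1 q) f := by
  rw [Finsupp.single_add, add_comm (Finsupp.single 0 p), add_assoc, MvPowerSeries.X,
    MvPowerSeries.coeff_add_monomial_mul, one_mul]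

theorem coeff_X_one_mul (f : MvPowerSeries (Fin 2) ℚ[X]) (p q : ℕ) :
    MvPowerSeries.coeff (Finsupp.single 0 p + Finsupp.single 1 (q + 1))
      (MvPowerSeries.X 1 * f) =
      MvPowerSeries.coeff (Finsupp.single 0 p + Finsupp.single 1 q) f := by
  rw [Finsupp.single_add, ← add_assoc, add_comm, MvPowerSeries.X,
    MvPowerSeries.coeff_add_monomial_mul, one_mul]

theorem coeff_X_one_mul_zero (f : MvPowerSeries (Fin 2) ℚ[X]) (p : ℕ) :
    MvPowerSeries.coeff (Finsupp.single 0 p + Finsupp.single 1 0) (MvPowerSeries.X 1 * f) = 0 := by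
  rw [MvPowerSeries.X, MvPowerSeries.coeff_monomial_mul, if_neg]
  simp

theorem gregoryPoly_eq (w q : ℕ) :
    gregoryPoly (q + 1) (w + 2) =
      ∑ m ∈ Finset.range (q + 1), ∑ k ∈ Finset.range (w + 1),
        PowerSeries.coeff (m + k + 1) bernoulliSeries *
          (PowerSeries.coeff q (negL ^ m) * PowerSeries.coeff (w + 1) (negL ^ (k + 1))) := by
  -- The extra summand `y l(x)` only meets `y^1`, whereas the exponent of `y` here is `w + 2`.
  have hlog : MvPowerSeries.coeff (Finsupp.single 0 (q + 1) + Finsupp.single 1 (w + 1))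
      (logSeries 0) = 0 := by
    rw [logSeries, PowerSeries.coeff_subst_single, if_neg]
    intro h
    simpa using DFunLike.congr_fun h 1
  rw [gregoryPoly, gregorySeries_eq, map_add, coeff_X_one_mul, hlog, add_zero, coeff_X_zero_mul,
    coeff_X_one_mul, coeff_subst_logSeries _ (Nat.lt_succ_self q) (Nat.lt_succ_self (w + 1))]
  refine Finset.sum_congr rfl fun m _ => ?_
  rw [Finset.sum_range_succ', coeff_X_one_mul_zero, zero_mul, add_zero]
  refine Finset.sum_congr rfl fun k _ => ?_
  rw [coeff_X_one_mul]
  congr 1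
  change PowerSeries.coeff _ bernoulliSeries = _
  simp

end HurwitzGregory

theorem mainTheorem2 (i r : ℕ) (hi : 1 ≤ i) (hir : i ≤ r) :
    HurwitzGregory.primCoeff i r = HurwitzGregory.gregoryPoly i (r - i + 2) := by
  obtain ⟨q, rfl⟩ := Nat.exists_eq_add_of_le' hi
  obtain ⟨w, rfl⟩ := Nat.exists_eq_add_of_le hir
  rw [Nat.add_sub_cancel_left, HurwitzGregory.primCoeff_eq_walkSum, HurwitzGregory.gregoryPoly_eq,
    HurwitzGregory.walkSum_crossing HurwitzGregory.constantCoeff_negL HurwitzGregory.negL_eq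
      HurwitzGregory.coeff_zero_bernoulliSeries]
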